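/- **Stabilization with static state feedback.** Consider the discrete-time system $$x(k+1)=A_0x(k)+A_1x(k-h_1(k))+Bu(k-h_2(k)),\qquad k\in\mathbb{Z}_{\ge 0},\qquad (1)$$ with $x(k)\in\mathbb{R}^n$, $u(k)\in\mathbb{R}^m$, constant (unknown) matrices $A_0,A_1\in\mathbb{R}^{n\times n}$, $B\in\mathbb{R}^{n\times m}$, and integer delays bounded by a known $\bar h\in\mathbb{Z}_{>0}$. Data: let $T>\bar h$ be an integer, and let $x_{[-\bar h,T]}$, $u_{[-\bar h,T]}$ be recorded (noise-free) sequences that satisfy (1) for $k=0,\dots,T-1$ with constant, known delays $h_1,h_2\in\{0,\dots,\bar h\}$. Put $$X_{\{i\}}=[x(i)\ \cdots\ x(T+i-1)]\ (i=0,1),\quad X_{h_1,\{0\}}=[x(-h_1)\ \cdots\ x(T-1-h_1)],\quad U_{h_2,\{0\}}=[u(-h_2)\ \cdots\ u(T-1-h_2)],$$ and let $W_0\in\mathbb{R}^{(m+2n)\times T}$ be obtained by stacking $U_{h_2,\{0\}}$, $X_{h_1,\{0\}}$ and $X_{\{0\}}$. Suppose that $\operatorname{rank}(W_0)=m+2n$.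 Let $\varepsilon>0$ and suppose that there are $n\times n$ matrices $\bar P,\bar S,\bar R_1,\bar R_2$ (symmetric positive definite) and $\bar S_{12,1},\bar S_{12,2}$, and $T\times n$ matrices $Q_1,Q_2,Q_3$, such that $$\bar{\mathbf\Phi}=\begin{bmatrix} \bar{\mathbf\Phi}_{11}&\bar{\mathbf\Phi}_{12}&\bar{\mathbf\Phi}_{13}&-\bar S_{12,1}-\bar S_{12,2}&\bar{\mathbf\Phi}_{15}\\ \star&2\bar R_1-\bar S_{12,1}-\bar S_{12,1}^\top&0&-\bar R_1+\bar S_{12,1}&-\varepsilon(X_{\{1\}}Q_2)^\top\\ \star&\star&2\bar R_2-\bar S_{12,2}-\bar S_{12,2}^\top&-\bar R_2+\bar S_{12,2}&-\varepsilon(X_{\{1\}}Q_1)^\top\\ \star&\star&\star&\bar R_1+\bar R_2+\bar S&0\\ \star&\star&\star&\star&\bar{\mathbf\Phi}_{55}\end{bmatrix}>0$$ (here $\star$ denotes the blocks determined by symmetry), where $$\begin{aligned} \bar{\mathbf\Phi}_{11}&=\bar P-\bar S+(1-\bar h^2)(\bar R_1+\bar R_2)-X_{\{1\}}Q_3-(X_{\{1\}}Q_3)^\top,\\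 \bar{\mathbf\Phi}_{12}&=-\bar R_1+\bar S_{12,1}-X_{\{1\}}Q_2,\qquad \bar{\mathbf\Phi}_{13}=-\bar R_2+\bar S_{12,2}-X_{\{1\}}Q_1,\\ \bar{\mathbf\Phi}_{15}&=\bar h^2(\bar R_1+\bar R_2)+X_{\{0\}}Q_3-\varepsilon(X_{\{1\}}Q_3)^\top,\\ \bar{\mathbf\Phi}_{55}&=-\bar P-\bar h^2(\bar R_1+\bar R_2)+\varepsilon(X_{\{0\}}Q_3+Q_3^\top X_{\{0\}}^\top), \end{aligned}$$ $$\begin{bmatrix}\bar R_i&\bar S_{12,i}\\ \bar S_{12,i}^\top&\bar R_i\end{bmatrix}\ge 0,\qquad i=1,2,$$ $$U_{h_2,\{0\}}Q_2=U_{h_2,\{0\}}Q_3=0,\quad X_{h_1,\{0\}}Q_1=X_{h_1,\{0\}}Q_3=0,\quad X_{\{0\}}Q_1=X_{\{0\}}Q_2=0,\quad X_{h_1,\{0\}}Q_2=X_{\{0\}}Q_3.$$ Then $X_{\{0\}}Q_3$ is invertible and, with the gain $K=U_{h_2,\{0\}}Q_1(X_{\{0\}}Q_3)^{-1}$, the origin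 of (1) in closed loop with $u(k)=Kx(k)$ is exponentially stable for all time-varying delays $h_1(k),h_2(k)\in[0,\bar h]$, $k\ge0$: there are $C>0$ and $\rho\in(0,1)$, independent of the delays and of the trajectory, such that $$\|x(k)\|_2\le C\rho^k\max_{-\bar h\le j\le 0}\|x(j)\|_2\qquad\text{for all }k\in\mathbb{Z}_{\ge0}$$ for all such delays, all initial states $x(j)$, $-\bar h\le j\le0$, and all inputs with $u(k)=Kx(k)$ for $k>0$ and past values $u(j)\in\{0,Kx(j)\}$ for $-\bar h\le j\le 0$ (in particular $u(j)=0$). -/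

import Mathlib

open scoped Matrix

/-- The Euclidean norm `√(vᵀ v)` of a vector. -/
noncomputable def euclNorm {n : ℕ} (v : Fin n → ℝ) : ℝ := Real.sqrt (v ⬝ᵥ v)

/-- The delayed signal `k ↦ z (k - h)`, for a constant delay `h`. -/
def delayed {p : ℕ} (z : ℤ → Fin p → ℝ) (h : ℕ) : ℤ → Fin p → ℝ := fun k => z (k - (h : ℤ))

/-- The data matrix `Z_{i} = [z(i) z(i+1) ⋯ z(T+i-1)]`. -/
def dataMatrix {p : ℕ} (z : ℤ → Fin p → ℝ) (i : ℤ) (T : ℕ) : Matrix (Fin p) (Fin T) ℝ :=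
  Matrix.of fun a t => z (i + ((t : ℕ) : ℤ)) a

/-- The matrix `W₀`, obtained by stacking `U_{h₂,{0}}`, `X_{h₁,{0}}` and `X_{0}`. -/
def dataW0 {n m : ℕ} (x : ℤ → Fin n → ℝ) (u : ℤ → Fin m → ℝ) (h₁ h₂ T : ℕ) :
    Matrix (Fin m ⊕ Fin n ⊕ Fin n) (Fin T) ℝ :=
  Matrix.fromRows (dataMatrix (delayed u h₂) 0 T)
    (Matrix.fromRows (dataMatrix (delayed x h₁) 0 T) (dataMatrix x 0 T))

/-- The signals `x`, `u` satisfy the system equation at time `k`, where the state delay is `h₁`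
and the input delay is `h₂`. -/
def SystemEqAt {n m : ℕ} (A₀ A₁ : Matrix (Fin n) (Fin n) ℝ) (B : Matrix (Fin n) (Fin m) ℝ)
    (x : ℤ → Fin n → ℝ) (u : ℤ → Fin m → ℝ) (h₁ h₂ k : ℕ) : Prop :=
  x ((k : ℤ) + 1) = A₀ *ᵥ x (k : ℤ) + A₁ *ᵥ x ((k : ℤ) - (h₁ : ℤ)) + B *ᵥ u ((k : ℤ) - (h₂ : ℤ))

/-- `x`, `u` is a trajectory of the system with time-varying delays `h₁ k`, `h₂ k` in closed loop
with `u(k) = K x(k)`.  The initial states `x j`, `-hbar ≤ j ≤ 0`, are arbitrary.  The past inputs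
`u j`, `-hbar ≤ j ≤ 0`, may be zero (the feedback is not yet in operation), and they may also be
given by the feedback law (so that the state alone obeys
`x(k+1) = A₀ x(k) + A₁ x(k - h₁ k) + B K x(k - h₂ k)` from time `0` on); time `0` may be counted
either as past or as present. -/
def IsClosedLoopTrajectory {n m : ℕ} (A₀ A₁ : Matrix (Fin n) (Fin n) ℝ)
    (B : Matrix (Fin n) (Fin m) ℝ) (K : Matrix (Fin m) (Fin n) ℝ) (hbar : ℕ) (h₁ h₂ : ℕ → ℕ)
    (x : ℤ → Fin n → ℝ) (u : ℤ → Fin m → ℝ) : Prop :=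
  (∀ k : ℕ, SystemEqAt A₀ A₁ B x u (h₁ k) (h₂ k) k) ∧
  (∀ k : ℤ, 0 < k → u k = K *ᵥ x k) ∧
  (∀ j : ℤ, -(hbar : ℤ) ≤ j → j ≤ 0 → u j = 0 ∨ u j = K *ᵥ x j)

/-- Exponential stability of the origin of the closed loop for all time-varying delays with values
in `[0, hbar]`: `‖x(k)‖ ≤ C ρ^k max_{-hbar ≤ j ≤ 0} ‖x(j)‖`, with `C` and `ρ < 1` that depend
neither on the delays nor on the trajectory.  (The maximum is expressed through its upper
bounds `M`.) -/
def ClosedLoopExpStable {n m : ℕ} (A₀ A₁ : Matrix (Fin n) (Fin n) ℝ)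
    (B : Matrix (Fin n) (Fin m) ℝ) (K : Matrix (Fin m) (Fin n) ℝ) (hbar : ℕ) : Prop :=
  ∃ C ρ : ℝ, 0 < C ∧ 0 < ρ ∧ ρ < 1 ∧
    ∀ h₁ h₂ : ℕ → ℕ, (∀ k, h₁ k ≤ hbar) → (∀ k, h₂ k ≤ hbar) →
      ∀ (x : ℤ → Fin n → ℝ) (u : ℤ → Fin m → ℝ),
        IsClosedLoopTrajectory A₀ A₁ B K hbar h₁ h₂ x u →
        ∀ M : ℝ, (∀ j : ℤ, -(hbar : ℤ) ≤ j → j ≤ 0 → euclNorm (x j) ≤ M) →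
          ∀ k : ℕ, euclNorm (x (k : ℤ)) ≤ C * ρ ^ k * M

/-- The symmetric `5n × 5n` block matrix of the linear matrix inequality.  Here `X₀`, `X₁` stand
for the data matrices `X_{0}`, `X_{1}`; `h` is the delay bound and `ε` the tuning parameter. -/
def lmiMatrix {n T : ℕ} (X₀ X₁ : Matrix (Fin n) (Fin T) ℝ) (h ε : ℝ)
    (P S R₁ R₂ S₁ S₂ : Matrix (Fin n) (Fin n) ℝ) (Q₁ Q₂ Q₃ : Matrix (Fin T) (Fin n) ℝ) :
    Matrix (Fin 5 × Fin n) (Fin 5 × Fin n) ℝ :=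
  let Φ₁₁ := P - S + (1 - h ^ 2) • (R₁ + R₂) - X₁ * Q₃ - (X₁ * Q₃)ᵀ
  let Φ₁₂ := -R₁ + S₁ - X₁ * Q₂
  let Φ₁₃ := -R₂ + S₂ - X₁ * Q₁
  let Φ₁₄ := -S₁ - S₂
  let Φ₁₅ := h ^ 2 • (R₁ + R₂) + X₀ * Q₃ - ε • (X₁ * Q₃)ᵀ
  let Φ₂₂ := (2 : ℝ) • R₁ - S₁ - S₁ᵀ
  let Φ₂₄ := -R₁ + S₁
  let Φ₂₅ := -(ε • (X₁ * Q₂)ᵀ)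
  let Φ₃₃ := (2 : ℝ) • R₂ - S₂ - S₂ᵀ
  let Φ₃₄ := -R₂ + S₂
  let Φ₃₅ := -(ε • (X₁ * Q₁)ᵀ)
  let Φ₄₄ := R₁ + R₂ + S
  let Φ₅₅ := -P - h ^ 2 • (R₁ + R₂) + ε • (X₀ * Q₃ + Q₃ᵀ * X₀ᵀ)
  Matrix.comp (Fin 5) (Fin 5) (Fin n) (Fin n) ℝ
    !![Φ₁₁,  Φ₁₂,  Φ₁₃,  Φ₁₄,  Φ₁₅;
       Φ₁₂ᵀ, Φ₂₂,  0,    Φ₂₄,  Φ₂₅;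
       Φ₁₃ᵀ, 0,    Φ₃₃,  Φ₃₄,  Φ₃₅;
       Φ₁₄ᵀ, Φ₂₄ᵀ, Φ₃₄ᵀ, Φ₄₄,  0;
       Φ₁₅ᵀ, Φ₂₅ᵀ, Φ₃₅ᵀ, 0,    Φ₅₅]


/-!
Since the data satisfy `X₁ = A₀ X₀ + A₁ Xh + B U`, the equality constraints say that
`X₁ Q₃ = A₀ Y`, `X₁ Q₂ = A₁ Y` and `X₁ Q₁ = B K Y`, where `Y = X₀ Q₃` and `K = U Q₁ Y⁻¹`. In the
coordinates `z = Y⁻¹ x` the closed loop is therefore the descriptor system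
`Y z⁺ = X₁ Q₃ z + X₁ Q₂ z(· - h₁) + X₁ Q₁ z(· - h₂)`, which contains only measured quantities.

The quadratic form of the linear matrix inequality, evaluated at `z`, the two delayed states, the
state at the maximal delay and `z⁺`, is the decrease of a Lyapunov–Krasovskii functional `V`, except
that the sum of squared increments over the delay window is replaced by the lower bound of the
reciprocally convex combination lemma, and that a multiple of the descriptor equation is added
(descriptor method). Hence `V` decreases by at least `c ‖z‖²` in every step. As `V` is bounded by
a multiple of the sum of `‖z‖²` over a window, it contracts by a fixed factor over one window.

During the first `hbar + 1` steps the past inputs may vanish instead of obeying the feedback law;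
there a crude growth bound suffices.
-/

section DotProduct

theorem posSemidef_of_fromBlocks {ι κ : Type*} {A : Matrix ι ι ℝ} {B : Matrix ι κ ℝ}
    {C : Matrix κ ι ℝ} {D : Matrix κ κ ℝ} (h : (Matrix.fromBlocks A B C D).PosSemidef) :
    A.PosSemidef :=
  h.submatrix Sum.inl

variable {ι κ : Type*} [Fintype ι] [Fintype κ]

theorem dotProduct_self_eq_norm_toLp_sq (v : ι → ℝ) : v ⬝ᵥ v = ‖WithLp.toLp 2 v‖ ^ 2 := by
  rw [EuclideanSpace.real_norm_sq_eq]
  simp [dotProduct, sq]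

theorem dotProduct_self_nonneg_real (v : ι → ℝ) : 0 ≤ v ⬝ᵥ v :=
  dotProduct_star_self_nonneg v

theorem dotProduct_self_sub_le (v w : ι → ℝ) :
    (v - w) ⬝ᵥ (v - w) ≤ 2 * (v ⬝ᵥ v + w ⬝ᵥ w) := by
  have h := dotProduct_self_nonneg_real (v + w)
  simp only [sub_dotProduct, dotProduct_sub, add_dotProduct, dotProduct_add] at h ⊢
  linarith

open scoped Matrix.Norms.L2Operator in
theorem norm_toLp_mulVec_le [DecidableEq κ] (A : Matrix ι κ ℝ) (v : κ → ℝ) :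
    ‖WithLp.toLp 2 (A *ᵥ v)‖ ≤ ‖A‖ * ‖WithLp.toLp 2 v‖ :=
  A.l2_opNorm_mulVec (WithLp.toLp 2 v)

open scoped Matrix.Norms.L2Operator in
theorem dotProduct_mulVec_self_le [DecidableEq ι] (A : Matrix ι ι ℝ) (v : ι → ℝ) :
    v ⬝ᵥ A *ᵥ v ≤ ‖A‖ * (v ⬝ᵥ v) := by
  calc v ⬝ᵥ A *ᵥ v = inner ℝ (WithLp.toLp 2 (A *ᵥ v)) (WithLp.toLp 2 v) := by
        rw [EuclideanSpace.inner_toLp_toLp, star_trivial]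
    _ ≤ ‖WithLp.toLp 2 (A *ᵥ v)‖ * ‖WithLp.toLp 2 v‖ := real_inner_le_norm _ _
    _ ≤ ‖A‖ * ‖WithLp.toLp 2 v‖ * ‖WithLp.toLp 2 v‖ := by gcongr; exact norm_toLp_mulVec_le A v
    _ = ‖A‖ * (v ⬝ᵥ v) := by rw [dotProduct_self_eq_norm_toLp_sq]; ring

open scoped MatrixOrder Matrix.Norms.L2Operator in
theorem exists_pos_mul_dotProduct_self_le {M : Matrix ι ι ℝ} (hM : M.PosDef) :
    ∃ c : ℝ, 0 < c ∧ ∀ v, c * (v ⬝ᵥ v) ≤ v ⬝ᵥ M *ᵥ v := by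
  classical
  cases isEmpty_or_nonempty ι
  · exact ⟨1, one_pos, fun v => by simp [dotProduct]⟩
  obtain ⟨c, hc, hcM⟩ := (CFC.exists_pos_algebraMap_le_iff hM.isHermitian).2
    fun _ hx => hM.isStrictlyPositive.spectrum_pos hx
  refine ⟨c, hc, fun v => ?_⟩
  have h := (Matrix.le_iff.1 hcM).dotProduct_mulVec_nonneg v
  simp only [Algebra.algebraMap_eq_smul_one, star_trivial, Matrix.sub_mulVec, Matrix.smul_mulVec,
    Matrix.one_mulVec, dotProduct_sub, dotProduct_smul, smul_eq_mul] at h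
  linarith

theorem dotProduct_mulVec_self_nonneg {M : Matrix ι ι ℝ} (hM : M.PosSemidef) (v : ι → ℝ) :
    0 ≤ v ⬝ᵥ M *ᵥ v :=
  hM.dotProduct_mulVec_nonneg v

theorem dotProduct_mulVec_comm_of_isSymm {R : Matrix ι ι ℝ} (hR : R.IsSymm) (v w : ι → ℝ) :
    v ⬝ᵥ R *ᵥ w = w ⬝ᵥ R *ᵥ v := by
  rw [← Matrix.dotProduct_transpose_mulVec, hR]

theorem two_mul_dotProduct_mulVec_le {R : Matrix ι ι ℝ} (hR : R.PosSemidef) (v w : ι → ℝ) :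
    2 * (v ⬝ᵥ R *ᵥ w) ≤ v ⬝ᵥ R *ᵥ v + w ⬝ᵥ R *ᵥ w := by
  have h := dotProduct_mulVec_self_nonneg hR (v - w)
  simp only [Matrix.mulVec_sub, sub_dotProduct, dotProduct_sub] at h
  linarith [dotProduct_mulVec_comm_of_isSymm (Matrix.isHermitian_iff_isSymm.1 hR.isHermitian) v w]

theorem two_mul_dotProduct_mulVec_le_of_fromBlocks {R S : Matrix ι ι ℝ}
    (h : (Matrix.fromBlocks R S Sᵀ R).PosSemidef) (v w : ι → ℝ) :
    2 * (v ⬝ᵥ S *ᵥ w) ≤ v ⬝ᵥ R *ᵥ v + w ⬝ᵥ R *ᵥ w := by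
  have hform := dotProduct_mulVec_self_nonneg h (Sum.elim v (-w))
  simp only [Matrix.fromBlocks_mulVec, sumElim_dotProduct_sumElim, Sum.elim_comp_inl,
    Sum.elim_comp_inr, dotProduct_add, Matrix.mulVec_neg, dotProduct_neg, neg_dotProduct,
    Matrix.dotProduct_transpose_mulVec] at hform
  linarith

theorem dotProduct_comp_mulVec_uncurry (M : Matrix ι ι (Matrix κ κ ℝ)) (w : ι → κ → ℝ) :
    Function.uncurry w ⬝ᵥ Matrix.comp ι ι κ κ ℝ M *ᵥ Function.uncurry w
      = ∑ i, ∑ j, w i ⬝ᵥ M i j *ᵥ w j := by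
  simp only [dotProduct, Matrix.mulVec, Matrix.comp_apply, Fintype.sum_prod_type, Finset.mul_sum,
    Function.uncurry_apply_pair]
  exact Finset.sum_congr rfl fun i _ => Finset.sum_comm

end DotProduct

section ReciprocallyConvex

variable {ι : Type*} [Fintype ι]

/-- The quadratic form of the block matrix `[R S; Sᵀ R]` at the consecutive differences
`(a - b, b - c)`.  It is the lower bound for `R`-weighted sums of squares in the reciprocally
convex combination lemma. -/
def recipConvexForm (R S : Matrix ι ι ℝ) (a b c : ι → ℝ) : ℝ :=
  (a - b) ⬝ᵥ R *ᵥ (a - b) + 2 * ((a - b) ⬝ᵥ S *ᵥ (b - c)) + (b - c) ⬝ᵥ R *ᵥ (b - c)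

theorem two_mul_sum_dotProduct_mulVec_sum_le {α β : Type*} (s : Finset α) (t : Finset β)
    (f : α → ι → ℝ) (g : β → ι → ℝ) {M R : Matrix ι ι ℝ}
    (h : ∀ v w, 2 * (v ⬝ᵥ M *ᵥ w) ≤ v ⬝ᵥ R *ᵥ v + w ⬝ᵥ R *ᵥ w) :
    2 * ((∑ i ∈ s, f i) ⬝ᵥ M *ᵥ (∑ j ∈ t, g j)) ≤
      t.card * ∑ i ∈ s, f i ⬝ᵥ R *ᵥ f i + s.card * ∑ j ∈ t, g j ⬝ᵥ R *ᵥ g j := by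
  calc 2 * ((∑ i ∈ s, f i) ⬝ᵥ M *ᵥ (∑ j ∈ t, g j))
      = ∑ i ∈ s, ∑ j ∈ t, 2 * (f i ⬝ᵥ M *ᵥ g j) := by
        simp only [Matrix.mulVec_sum, sum_dotProduct, dotProduct_sum, Finset.mul_sum]
        rw [Finset.sum_comm]
    _ ≤ ∑ i ∈ s, ∑ j ∈ t, (f i ⬝ᵥ R *ᵥ f i + g j ⬝ᵥ R *ᵥ g j) :=
        Finset.sum_le_sum fun i _ => Finset.sum_le_sum fun j _ => h _ _
    _ = t.card * ∑ i ∈ s, f i ⬝ᵥ R *ᵥ f i + s.card * ∑ j ∈ t, g j ⬝ᵥ R *ᵥ g j := by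
        simp only [Finset.sum_add_distrib, Finset.sum_const, nsmul_eq_mul, Finset.mul_sum]

-- Telescoping turns the three terms of the form into double sums over the blocks
-- `[b, c) × [b, c)`, `[b, c) × [a, b)` and `[a, b) × [a, b)` of the square `[a, c) × [a, c)`.
theorem recipConvexForm_le_mul_sum_Ico {R S : Matrix ι ι ℝ}
    (hRS : (Matrix.fromBlocks R S Sᵀ R).PosSemidef) (z : ℕ → ι → ℝ) {a b c : ℕ}
    (hab : a ≤ b) (hbc : b ≤ c) :
    recipConvexForm R S (z c) (z b) (z a) ≤
      ((c : ℝ) - a) * ∑ i ∈ Finset.Ico a c, (z (i + 1) - z i) ⬝ᵥ R *ᵥ (z (i + 1) - z i) := by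
  have hR := two_mul_dotProduct_mulVec_le (posSemidef_of_fromBlocks hRS)
  have hS := two_mul_dotProduct_mulVec_le_of_fromBlocks hRS
  have block {M : Matrix ι ι ℝ} (hM : ∀ v w, 2 * (v ⬝ᵥ M *ᵥ w) ≤ v ⬝ᵥ R *ᵥ v + w ⬝ᵥ R *ᵥ w)
      (s t : Finset ℕ) := two_mul_sum_dotProduct_mulVec_sum_le s t
        (fun i => z (i + 1) - z i) (fun i => z (i + 1) - z i) hM
  have hbb := block hR (Finset.Ico b c) (Finset.Ico b c)
  have hba := block hS (Finset.Ico b c) (Finset.Ico a b)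
  have haa := block hR (Finset.Ico a b) (Finset.Ico a b)
  simp only [Finset.sum_Ico_sub _ hab, Finset.sum_Ico_sub _ hbc, Nat.card_Ico,
    Nat.cast_sub hab, Nat.cast_sub hbc] at hbb hba haa
  rw [recipConvexForm, ← Finset.sum_Ico_consecutive _ hab hbc]
  linarith

end ReciprocallyConvex

section Decay

theorem exists_geometric_decay {N : ℕ} (hN : 0 < N) {q : ℝ} (hq0 : 0 < q) (hq1 : q < 1) :
    ∃ r : ℝ, 0 < r ∧ r < 1 ∧ ∀ V : ℕ → ℝ, 0 ≤ V 0 → Antitone V →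
      (∀ k, V (k + N) ≤ q * V k) → ∀ k, V k ≤ q⁻¹ * r ^ k * V 0 := by
  obtain ⟨r, hr0, hr⟩ : ∃ r : ℝ, 0 < r ∧ r ^ N = q :=
    ⟨q ^ (N : ℝ)⁻¹, Real.rpow_pos_of_pos hq0 _, Real.rpow_inv_natCast_pow hq0.le hN.ne'⟩
  have hr1 : r < 1 := (pow_lt_one_iff_of_nonneg hr0.le hN.ne').1 (hr ▸ hq1)
  refine ⟨r, hr0, hr1, fun V hV hanti hstep k => ?_⟩
  induction k using Nat.strong_induction_on with
  | _ k ih =>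
    rcases lt_or_ge k N with hk | hk
    · have hcoef : 1 ≤ q⁻¹ * r ^ k := by
        rw [inv_mul_eq_div, one_le_div hq0, ← hr]
        exact pow_le_pow_of_le_one hr0.le hr1.le hk.le
      exact (hanti k.zero_le).trans (le_mul_of_one_le_left hV hcoef)
    · obtain ⟨j, rfl⟩ := Nat.exists_eq_add_of_le' hk
      calc V (j + N) ≤ q * V j := hstep j
        _ ≤ q * (q⁻¹ * r ^ j * V 0) := by gcongr; exact ih j (by omega)
        _ = q⁻¹ * r ^ (j + N) * V 0 := by rw [pow_add, hr]; ring

theorem sum_range_le_sub_of_succ_le {V g : ℕ → ℝ} (h : ∀ k, V (k + 1) ≤ V k - g k) (k N : ℕ) :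
    ∑ i ∈ Finset.range N, g (k + i) ≤ V k - V (k + N) := by
  induction N with
  | zero => simp
  | succ N ih =>
    rw [Finset.sum_range_succ, ← add_assoc k]
    linarith [h (k + N)]

-- Summing the dissipation over one window gives `V (k + h + 1) ≤ (b / c) * (V k - V (k + h + 1))`,
-- a contraction by the factor `(1 + c / b)⁻¹`.
theorem exists_decay_of_dissipation (h : ℕ) {b c : ℝ} (hb : 0 < b) (hc : 0 < c) :
    ∃ C r : ℝ, 0 < C ∧ 0 < r ∧ r < 1 ∧ ∀ V s : ℕ → ℝ, 0 ≤ V 0 → (∀ k, 0 ≤ s k) →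
      (∀ k, V (k + 1) ≤ V k - c * s (k + h)) →
      (∀ k, V k ≤ b * ∑ i ∈ Finset.range (h + 1), s (k + i)) →
      ∀ k, V k ≤ C * r ^ k * V 0 := by
  have hq : 0 < 1 + c / b := by positivity
  obtain ⟨r, hr0, hr1, hdec⟩ := exists_geometric_decay h.succ_pos (inv_pos.2 hq)
    (inv_lt_one_of_one_lt₀ (by linarith [div_pos hc hb]))
  refine ⟨(1 + c / b)⁻¹⁻¹, r, by positivity, hr0, hr1, fun V s hV hs hstep hup => ?_⟩
  have hanti : Antitone V :=
    antitone_nat_of_succ_le fun k => by nlinarith [hstep k, hs (k + h)]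
  refine hdec V hV hanti fun k => ?_
  have hloss : c * ∑ i ∈ Finset.range (h + 1), s (k + h + i) ≤ V k - V (k + (h + 1)) := by
    simpa only [Finset.mul_sum, add_right_comm k _ h] using
      sum_range_le_sub_of_succ_le hstep k (h + 1)
  have hwindow : V (k + (h + 1)) ≤ b * ∑ i ∈ Finset.range (h + 1), s (k + h + i) :=
    (hanti (by omega)).trans (hup (k + h))
  have hcontr : c / b * V (k + (h + 1)) ≤ V k - V (k + (h + 1)) := by
    refine le_trans ?_ hloss
    rw [div_mul_eq_mul_div, div_le_iff₀ hb]
    nlinarith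
  rw [inv_mul_eq_div, le_div_iff₀ hq]
  linarith

theorem le_geometric_of_shift {a : ℕ → ℝ} {C ρ D : ℝ} {N : ℕ} (hC : 0 ≤ C) (hρ0 : 0 < ρ)
    (hρ1 : ρ ≤ 1) (hD : 0 ≤ D) (hinit : ∀ k < N, a k ≤ D)
    (hshift : ∀ k, a (k + N) ≤ C * ρ ^ k * D) (k : ℕ) :
    a k ≤ (1 + C) / ρ ^ N * ρ ^ k * D := by
  rcases lt_or_ge k N with hk | hk
  · refine (hinit k hk).trans (le_mul_of_one_le_left hD ?_)
    rw [div_mul_eq_mul_div, one_le_div (by positivity)]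
    calc ρ ^ N ≤ ρ ^ k := pow_le_pow_of_le_one hρ0.le hρ1 hk.le
      _ ≤ (1 + C) * ρ ^ k := le_mul_of_one_le_left (by positivity) (by linarith)
  · obtain ⟨j, rfl⟩ := Nat.exists_eq_add_of_le' hk
    calc a (j + N) ≤ C * ρ ^ j * D := hshift j
      _ ≤ (1 + C) * ρ ^ j * D := by gcongr; linarith
      _ = (1 + C) / ρ ^ N * ρ ^ (j + N) * D := by rw [pow_add]; field_simp

end Decay

section LyapunovKrasovskii

variable {ι : Type*} [Fintype ι]

/-- The Lyapunov–Krasovskii functional `zᵀ P z + ∑ zᵀ S z + h ∑ ∑ ηᵀ R η` on the window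
`k, …, k + h`, where `η` is the increment of `z`.  The double sum is written as a weighted simple
sum, and the present time is the right end `k + h` of the window, so that no index is negative. -/
def lyapunovKrasovskii (h : ℕ) (P S R : Matrix ι ι ℝ) (z : ℕ → ι → ℝ) (k : ℕ) : ℝ :=
  z (k + h) ⬝ᵥ P *ᵥ z (k + h) + ∑ i ∈ Finset.range h, z (k + i) ⬝ᵥ S *ᵥ z (k + i) +
    h * ∑ i ∈ Finset.range h,
      ((i : ℝ) + 1) * ((z (k + i + 1) - z (k + i)) ⬝ᵥ R *ᵥ (z (k + i + 1) - z (k + i)))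

theorem sum_window_succ (f : ℕ → ℝ) (k h : ℕ) :
    ∑ i ∈ Finset.range h, f (k + 1 + i) = ∑ i ∈ Finset.range h, f (k + i) + f (k + h) - f k := by
  rw [← Finset.sum_range_succ (fun i => f (k + i)), Finset.sum_range_succ' (fun i => f (k + i))]
  simp [add_assoc, add_comm 1]

theorem weighted_sum_window_succ (f : ℕ → ℝ) (k h : ℕ) :
    ∑ i ∈ Finset.range h, ((i : ℝ) + 1) * f (k + 1 + i) =
      ∑ i ∈ Finset.range h, ((i : ℝ) + 1) * f (k + i) + h * f (k + h)
        - ∑ i ∈ Finset.range h, f (k + i) := by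
  have hshift := Finset.sum_range_succ (fun i : ℕ => (i : ℝ) * f (k + i)) h
  rw [Finset.sum_range_succ'] at hshift
  simp only [Nat.cast_zero, zero_mul, add_zero, Nat.cast_add, Nat.cast_one, ← add_assoc] at hshift
  simp only [add_mul, one_mul, Finset.sum_add_distrib, add_right_comm k 1] at hshift ⊢
  linarith

theorem lyapunovKrasovskii_succ (h : ℕ) (P S R : Matrix ι ι ℝ) (z : ℕ → ι → ℝ) (k : ℕ) :
    lyapunovKrasovskii h P S R z (k + 1) = lyapunovKrasovskii h P S R z k
      + z (k + h + 1) ⬝ᵥ P *ᵥ z (k + h + 1) - z (k + h) ⬝ᵥ P *ᵥ z (k + h)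
      + z (k + h) ⬝ᵥ S *ᵥ z (k + h) - z k ⬝ᵥ S *ᵥ z k
      + (h : ℝ) ^ 2 * ((z (k + h + 1) - z (k + h)) ⬝ᵥ R *ᵥ (z (k + h + 1) - z (k + h)))
      - h * ∑ i ∈ Finset.Ico k (k + h), (z (i + 1) - z i) ⬝ᵥ R *ᵥ (z (i + 1) - z i) := by
  have hS := sum_window_succ (fun i => z i ⬝ᵥ S *ᵥ z i) k h
  have hR := weighted_sum_window_succ (fun i => (z (i + 1) - z i) ⬝ᵥ R *ᵥ (z (i + 1) - z i)) k h
  rw [Finset.sum_Ico_eq_sum_range, Nat.add_sub_cancel_left]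
  simp only [lyapunovKrasovskii, hS, hR, add_right_comm k 1 h]
  ring

theorem le_lyapunovKrasovskii (h : ℕ) (P : Matrix ι ι ℝ) {S R : Matrix ι ι ℝ} (hS : S.PosSemidef)
    (hR : R.PosSemidef) (z : ℕ → ι → ℝ) (k : ℕ) :
    z (k + h) ⬝ᵥ P *ᵥ z (k + h) ≤ lyapunovKrasovskii h P S R z k := by
  have hSz : 0 ≤ ∑ i ∈ Finset.range h, z (k + i) ⬝ᵥ S *ᵥ z (k + i) :=
    Finset.sum_nonneg fun i _ => dotProduct_mulVec_self_nonneg hS _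
  have hRη : 0 ≤ h * ∑ i ∈ Finset.range h,
      ((i : ℝ) + 1) * ((z (k + i + 1) - z (k + i)) ⬝ᵥ R *ᵥ (z (k + i + 1) - z (k + i))) :=
    mul_nonneg h.cast_nonneg <| Finset.sum_nonneg fun i _ =>
      mul_nonneg (by positivity) (dotProduct_mulVec_self_nonneg hR _)
  rw [lyapunovKrasovskii]
  linarith

open scoped Matrix.Norms.L2Operator in
theorem lyapunovKrasovskii_le [DecidableEq ι] (h : ℕ) (P S R : Matrix ι ι ℝ) (z : ℕ → ι → ℝ)
    (k : ℕ) :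
    lyapunovKrasovskii h P S R z k ≤
      (‖P‖ + ‖S‖ + 4 * h ^ 2 * ‖R‖) * ∑ i ∈ Finset.range (h + 1), z (k + i) ⬝ᵥ z (k + i) := by
  set e : ℕ → ℝ := fun i => z (k + i) ⬝ᵥ z (k + i)
  set E := ∑ i ∈ Finset.range (h + 1), e i
  have he (i : ℕ) : 0 ≤ e i := dotProduct_self_nonneg_real _
  have hinit : ∑ i ∈ Finset.range h, e i ≤ E :=
    (le_add_of_nonneg_right (he h)).trans_eq (Finset.sum_range_succ e h).symm
  have htail : ∑ i ∈ Finset.range h, e (i + 1) ≤ E :=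
    (le_add_of_nonneg_right (he 0)).trans_eq (Finset.sum_range_succ' e h).symm
  have hlast : e h ≤ E := Finset.single_le_sum (fun i _ => he i) (Finset.self_mem_range_succ h)
  have hP : z (k + h) ⬝ᵥ P *ᵥ z (k + h) ≤ ‖P‖ * E :=
    (dotProduct_mulVec_self_le P _).trans (by gcongr)
  have hS : ∑ i ∈ Finset.range h, z (k + i) ⬝ᵥ S *ᵥ z (k + i) ≤ ‖S‖ * E :=
    calc _ ≤ ∑ i ∈ Finset.range h, ‖S‖ * e i :=
          Finset.sum_le_sum fun i _ => dotProduct_mulVec_self_le S _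
      _ ≤ ‖S‖ * E := by rw [← Finset.mul_sum]; gcongr
  have hη (i : ℕ) : (z (k + i + 1) - z (k + i)) ⬝ᵥ R *ᵥ (z (k + i + 1) - z (k + i)) ≤
      ‖R‖ * (2 * (e (i + 1) + e i)) :=
    (dotProduct_mulVec_self_le R _).trans (by gcongr; exact dotProduct_self_sub_le _ _)
  have hR : ∑ i ∈ Finset.range h,
      ((i : ℝ) + 1) * ((z (k + i + 1) - z (k + i)) ⬝ᵥ R *ᵥ (z (k + i + 1) - z (k + i))) ≤
        h * (‖R‖ * (2 * (E + E))) :=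
    calc _ ≤ ∑ i ∈ Finset.range h, h * (‖R‖ * (2 * (e (i + 1) + e i))) := by
          refine Finset.sum_le_sum fun i hi => ?_
          have hih : (i : ℝ) + 1 ≤ h := by exact_mod_cast Finset.mem_range.1 hi
          have := add_nonneg (he (i + 1)) (he i)
          exact (mul_le_mul_of_nonneg_left (hη i) (by positivity)).trans
            (mul_le_mul_of_nonneg_right hih (by positivity))
      _ ≤ h * (‖R‖ * (2 * (E + E))) := by
          simp only [← Finset.mul_sum, Finset.sum_add_distrib]
          gcongr
  rw [lyapunovKrasovskii]
  linarith [mul_le_mul_of_nonneg_left hR h.cast_nonneg]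

end LyapunovKrasovskii

section EuclideanNorm

variable {m n : ℕ}

theorem euclNorm_eq_norm_toLp (v : Fin n → ℝ) : euclNorm v = ‖WithLp.toLp 2 v‖ := by
  rw [euclNorm, dotProduct_self_eq_norm_toLp_sq, Real.sqrt_sq (norm_nonneg _)]

theorem euclNorm_nonneg (v : Fin n → ℝ) : 0 ≤ euclNorm v :=
  Real.sqrt_nonneg _

theorem euclNorm_sq (v : Fin n → ℝ) : euclNorm v ^ 2 = v ⬝ᵥ v :=
  Real.sq_sqrt (dotProduct_self_nonneg_real v)

theorem euclNorm_zero : euclNorm (0 : Fin n → ℝ) = 0 := by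
  simp [euclNorm]

theorem euclNorm_add_le (v w : Fin n → ℝ) : euclNorm (v + w) ≤ euclNorm v + euclNorm w := by
  simpa only [euclNorm_eq_norm_toLp, WithLp.toLp_add] using
    norm_add_le (WithLp.toLp 2 v) (WithLp.toLp 2 w)

open scoped Matrix.Norms.L2Operator in
theorem euclNorm_mulVec_le (A : Matrix (Fin m) (Fin n) ℝ) (v : Fin n → ℝ) :
    euclNorm (A *ᵥ v) ≤ ‖A‖ * euclNorm v := by
  simpa only [euclNorm_eq_norm_toLp] using norm_toLp_mulVec_le A v

end EuclideanNorm

section DelaySystem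

variable {n p : ℕ}

/-- `z` solves the delay difference inclusion `z⁺ ∈ {F₀ z + F₁ z(· - d₁) + F₂ z(· - d₂)}` with
arbitrary time-varying delays `d₁, d₂ ∈ {0, …, h}`.  As in `lyapunovKrasovskii`, the present time
is the right end `k + h` of a window `k, …, k + h`; the delays are `h - i` and `h - j`. -/
def IsDelaySolution (F₀ F₁ F₂ : Matrix (Fin n) (Fin n) ℝ) (h : ℕ) (z : ℕ → Fin n → ℝ) : Prop :=
  ∀ k, ∃ i ≤ h, ∃ j ≤ h, z (k + h + 1) = F₀ *ᵥ z (k + h) + F₁ *ᵥ z (k + i) + F₂ *ᵥ z (k + j)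

/-- Exponential stability of the origin of a delay difference inclusion, uniformly in the delays;
`M` bounds the initial window `z 0, …, z h`. -/
def DelayExpStable (F₀ F₁ F₂ : Matrix (Fin n) (Fin n) ℝ) (h : ℕ) : Prop :=
  ∃ C ρ : ℝ, 0 < C ∧ 0 < ρ ∧ ρ < 1 ∧ ∀ z, IsDelaySolution F₀ F₁ F₂ h z →
    ∀ M, (∀ l ≤ h, euclNorm (z l) ≤ M) → ∀ k, euclNorm (z (k + h)) ≤ C * ρ ^ k * M

variable {F₀ F₁ F₂ : Matrix (Fin n) (Fin n) ℝ} {G₀ G₁ G₂ : Matrix (Fin p) (Fin p) ℝ} {h : ℕ}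

theorem IsDelaySolution.mulVec {z : ℕ → Fin n → ℝ} (hz : IsDelaySolution F₀ F₁ F₂ h z)
    {L : Matrix (Fin p) (Fin n) ℝ} (h₀ : L * F₀ = G₀ * L) (h₁ : L * F₁ = G₁ * L)
    (h₂ : L * F₂ = G₂ * L) : IsDelaySolution G₀ G₁ G₂ h fun k => L *ᵥ z k := by
  intro k
  obtain ⟨i, hi, j, hj, hk⟩ := hz k
  refine ⟨i, hi, j, hj, ?_⟩
  simp only [hk, Matrix.mulVec_add, Matrix.mulVec_mulVec, h₀, h₁, h₂]

open scoped Matrix.Norms.L2Operator in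
theorem DelayExpStable.of_leftInverse (hG : DelayExpStable G₀ G₁ G₂ h)
    {L : Matrix (Fin p) (Fin n) ℝ} {L' : Matrix (Fin n) (Fin p) ℝ} (hL : L' * L = 1)
    (h₀ : L * F₀ = G₀ * L) (h₁ : L * F₁ = G₁ * L) (h₂ : L * F₂ = G₂ * L) :
    DelayExpStable F₀ F₁ F₂ h := by
  obtain ⟨C, ρ, hC, hρ0, hρ1, hdec⟩ := hG
  refine ⟨‖L'‖ * C * ‖L‖ + 1, ρ, by positivity, hρ0, hρ1, fun z hz M hM k => ?_⟩
  have hM0 : 0 ≤ M := (euclNorm_nonneg _).trans (hM 0 h.zero_le)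
  have hLz : ∀ l ≤ h, euclNorm (L *ᵥ z l) ≤ ‖L‖ * M := fun l hl =>
    (euclNorm_mulVec_le L _).trans (by gcongr; exact hM l hl)
  calc euclNorm (z (k + h)) = euclNorm (L' *ᵥ L *ᵥ z (k + h)) := by
        rw [Matrix.mulVec_mulVec, hL, Matrix.one_mulVec]
    _ ≤ ‖L'‖ * euclNorm (L *ᵥ z (k + h)) := euclNorm_mulVec_le _ _
    _ ≤ ‖L'‖ * (C * ρ ^ k * (‖L‖ * M)) := by
        gcongr
        exact hdec _ (hz.mulVec h₀ h₁ h₂) _ hLz k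
    _ = ‖L'‖ * C * ‖L‖ * ρ ^ k * M := by ring
    _ ≤ (‖L'‖ * C * ‖L‖ + 1) * ρ ^ k * M := by gcongr; linarith

theorem delayExpStable_of_dissipation {V : (ℕ → Fin n → ℝ) → ℕ → ℝ} {a b c : ℝ} (ha : 0 < a)
    (hb : 0 < b) (hc : 0 < c) (hlow : ∀ z k, a * (z (k + h) ⬝ᵥ z (k + h)) ≤ V z k)
    (hup : ∀ z k, V z k ≤ b * ∑ i ∈ Finset.range (h + 1), z (k + i) ⬝ᵥ z (k + i))
    (hdiss : ∀ z, IsDelaySolution F₀ F₁ F₂ h z →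
      ∀ k, V z (k + 1) ≤ V z k - c * (z (k + h) ⬝ᵥ z (k + h))) :
    DelayExpStable F₀ F₁ F₂ h := by
  obtain ⟨C, r, hC, hr0, hr1, hdec⟩ := exists_decay_of_dissipation h hb hc
  refine ⟨√(C * (b * (h + 1)) / a), √r, by positivity, Real.sqrt_pos.2 hr0,
    (Real.sqrt_lt' one_pos).2 (by simpa using hr1), fun z hz M hM k => ?_⟩
  have hM0 : 0 ≤ M := (euclNorm_nonneg _).trans (hM 0 h.zero_le)
  have hV0 : V z 0 ≤ b * ((h + 1) * M ^ 2) :=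
    calc V z 0 ≤ b * ∑ i ∈ Finset.range (h + 1), z (0 + i) ⬝ᵥ z (0 + i) := hup z 0
      _ ≤ b * ∑ i ∈ Finset.range (h + 1), M ^ 2 := by
          gcongr with i hi
          rw [zero_add, ← euclNorm_sq]
          exact pow_le_pow_left₀ (euclNorm_nonneg _)
            (hM i (Nat.lt_succ_iff.1 (Finset.mem_range.1 hi))) 2
      _ = b * ((h + 1) * M ^ 2) := by simp
  have hVk : V z k ≤ C * r ^ k * V z 0 :=
    hdec (V z) (fun i => z i ⬝ᵥ z i)
      ((mul_nonneg ha.le (dotProduct_self_nonneg_real _)).trans (hlow z 0))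
      (fun _ => dotProduct_self_nonneg_real _) (hdiss z hz) (hup z) k
  refine (pow_le_pow_iff_left₀ (euclNorm_nonneg _) (by positivity) two_ne_zero).1 ?_
  calc euclNorm (z (k + h)) ^ 2 ≤ V z k / a := by
        rw [euclNorm_sq, le_div_iff₀' ha]; exact hlow z k
    _ ≤ C * r ^ k * (b * ((h + 1) * M ^ 2)) / a := by
        gcongr; exact hVk.trans (by gcongr)
    _ = (√(C * (b * (h + 1)) / a) * √r ^ k * M) ^ 2 := by
        rw [mul_pow, mul_pow, pow_right_comm, Real.sq_sqrt (by positivity), Real.sq_sqrt hr0.le]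
        ring

end DelaySystem

section LinearMatrixInequality

variable {n T h : ℕ} {X₀ X₁ : Matrix (Fin n) (Fin T) ℝ} {ε : ℝ}
  {P S R₁ R₂ S₁ S₂ : Matrix (Fin n) (Fin n) ℝ} {Q₁ Q₂ Q₃ : Matrix (Fin T) (Fin n) ℝ}

-- The last summand vanishes along solutions of the descriptor system
-- `X₀ Q₃ zp = X₁ Q₃ z + X₁ Q₂ z₁ + X₁ Q₁ z₂`.
theorem uncurry_dotProduct_lmiMatrix_mulVec (hR₁ : R₁.IsSymm) (hR₂ : R₂.IsSymm) (η : ℝ)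
    (z z₁ z₂ zh zp : Fin n → ℝ) :
    Function.uncurry ![z, z₁, z₂, zh, zp] ⬝ᵥ
        lmiMatrix X₀ X₁ η ε P S R₁ R₂ S₁ S₂ Q₁ Q₂ Q₃ *ᵥ Function.uncurry ![z, z₁, z₂, zh, zp]
      = z ⬝ᵥ P *ᵥ z - zp ⬝ᵥ P *ᵥ zp - z ⬝ᵥ S *ᵥ z + zh ⬝ᵥ S *ᵥ zh
        - η ^ 2 * ((zp - z) ⬝ᵥ (R₁ + R₂) *ᵥ (zp - z))
        + recipConvexForm R₁ S₁ z z₁ zh + recipConvexForm R₂ S₂ z z₂ zh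
        + 2 * ((z + ε • zp) ⬝ᵥ ((X₀ * Q₃) *ᵥ zp -
            ((X₁ * Q₃) *ᵥ z + (X₁ * Q₂) *ᵥ z₁ + (X₁ * Q₁) *ᵥ z₂))) := by
  have hX : Q₃ᵀ * X₀ᵀ = (X₀ * Q₃)ᵀ := (Matrix.transpose_mul _ _).symm
  simp only [lmiMatrix, dotProduct_comp_mulVec_uncurry, hX, recipConvexForm]
  generalize X₀ * Q₃ = Y
  generalize X₁ * Q₁ = M₁
  generalize X₁ * Q₂ = M₂
  generalize X₁ * Q₃ = M₃
  simp only [Fin.sum_univ_five, Matrix.of_apply, Matrix.cons_val, Matrix.cons_val_zero,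
    Matrix.cons_val_one]
  simp only [Matrix.transpose_add, Matrix.transpose_sub, Matrix.transpose_neg,
    Matrix.transpose_smul, Matrix.transpose_transpose, hR₁.eq, hR₂.eq, Matrix.add_mulVec,
    Matrix.sub_mulVec, Matrix.neg_mulVec, Matrix.smul_mulVec, Matrix.zero_mulVec, dotProduct_zero,
    Matrix.mulVec_sub, dotProduct_add, dotProduct_sub, dotProduct_neg, dotProduct_smul,
    add_dotProduct, sub_dotProduct, smul_dotProduct, smul_eq_mul,
    Matrix.dotProduct_transpose_mulVec]
  rw [dotProduct_mulVec_comm_of_isSymm hR₁ zp z, dotProduct_mulVec_comm_of_isSymm hR₁ z₁ z,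
    dotProduct_mulVec_comm_of_isSymm hR₁ zh z₁, dotProduct_mulVec_comm_of_isSymm hR₂ zp z,
    dotProduct_mulVec_comm_of_isSymm hR₂ z₂ z, dotProduct_mulVec_comm_of_isSymm hR₂ zh z₂]
  ring

-- The block `Φ₅₅` is negative semidefinite on the kernel of `X₀ Q₃`.
theorem isUnit_of_lmiMatrix_posDef {η : ℝ} (hP : P.PosSemidef) (hR₁ : R₁.PosSemidef)
    (hR₂ : R₂.PosSemidef) (hΦ : (lmiMatrix X₀ X₁ η ε P S R₁ R₂ S₁ S₂ Q₁ Q₂ Q₃).PosDef) :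
    IsUnit (X₀ * Q₃) := by
  rw [← Matrix.mulVec_injective_iff_isUnit, ← Matrix.coe_mulVecLin, ← LinearMap.ker_eq_bot,
    LinearMap.ker_eq_bot']
  intro v hv
  rw [Matrix.mulVecLin_apply] at hv
  by_contra hv0
  have hne : Function.uncurry (![0, 0, 0, 0, v] : Fin 5 → Fin n → ℝ) ≠ 0 := fun h0 =>
    hv0 (funext fun a => by simpa using congrFun h0 (4, a))
  have hpos := hΦ.dotProduct_mulVec_pos hne
  rw [star_trivial, uncurry_dotProduct_lmiMatrix_mulVec
    (Matrix.isHermitian_iff_isSymm.1 hR₁.isHermitian)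
    (Matrix.isHermitian_iff_isSymm.1 hR₂.isHermitian), hv] at hpos
  simp only [recipConvexForm, Matrix.mulVec_zero, dotProduct_zero, sub_zero, add_zero, zero_sub,
    mul_zero] at hpos
  have hPv := dotProduct_mulVec_self_nonneg hP v
  have hRv := mul_nonneg (sq_nonneg η) (dotProduct_mulVec_self_nonneg (hR₁.add hR₂) v)
  linarith

theorem lyapunovKrasovskii_dissipation {c : ℝ} (hc : 0 ≤ c)
    (hΦ : ∀ v, c * (v ⬝ᵥ v) ≤ v ⬝ᵥ lmiMatrix X₀ X₁ (h : ℝ) ε P S R₁ R₂ S₁ S₂ Q₁ Q₂ Q₃ *ᵥ v)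
    (hRS₁ : (Matrix.fromBlocks R₁ S₁ S₁ᵀ R₁).PosSemidef)
    (hRS₂ : (Matrix.fromBlocks R₂ S₂ S₂ᵀ R₂).PosSemidef) {z : ℕ → Fin n → ℝ} {k i j : ℕ}
    (hi : i ≤ h) (hj : j ≤ h)
    (hz : (X₀ * Q₃) *ᵥ z (k + h + 1) =
      (X₁ * Q₃) *ᵥ z (k + h) + (X₁ * Q₂) *ᵥ z (k + i) + (X₁ * Q₁) *ᵥ z (k + j)) :
    lyapunovKrasovskii h P S (R₁ + R₂) z (k + 1) ≤
      lyapunovKrasovskii h P S (R₁ + R₂) z k - c * (z (k + h) ⬝ᵥ z (k + h)) := by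
  set w := ![z (k + h), z (k + i), z (k + j), z k, z (k + h + 1)]
  have hw : c * (z (k + h) ⬝ᵥ z (k + h)) ≤ c * (Function.uncurry w ⬝ᵥ Function.uncurry w) := by
    gcongr
    rw [dotProduct, dotProduct, Fintype.sum_prod_type, Fin.sum_univ_succ]
    exact le_add_of_nonneg_right
      (Finset.sum_nonneg fun _ _ => Finset.sum_nonneg fun _ _ => mul_self_nonneg _)
  have hlmi := hw.trans (hΦ (Function.uncurry w))
  rw [uncurry_dotProduct_lmiMatrix_mulVec
    (Matrix.isHermitian_iff_isSymm.1 (posSemidef_of_fromBlocks hRS₁).isHermitian)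
    (Matrix.isHermitian_iff_isSymm.1 (posSemidef_of_fromBlocks hRS₂).isHermitian),
    hz, sub_self, dotProduct_zero, mul_zero, add_zero] at hlmi
  have hjensen₁ := recipConvexForm_le_mul_sum_Ico hRS₁ z (Nat.le_add_right k i)
    (Nat.add_le_add_left hi k)
  have hjensen₂ := recipConvexForm_le_mul_sum_Ico hRS₂ z (Nat.le_add_right k j)
    (Nat.add_le_add_left hj k)
  rw [Nat.cast_add, add_sub_cancel_left] at hjensen₁ hjensen₂
  rw [lyapunovKrasovskii_succ]
  simp only [Matrix.add_mulVec, dotProduct_add, Finset.sum_add_distrib] at hlmi ⊢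
  linarith

open scoped Matrix.Norms.L2Operator in
theorem delayExpStable_of_lmiMatrix_posDef {F₀ F₁ F₂ : Matrix (Fin n) (Fin n) ℝ}
    (hP : P.PosDef) (hS : S.PosSemidef)
    (hΦ : (lmiMatrix X₀ X₁ (h : ℝ) ε P S R₁ R₂ S₁ S₂ Q₁ Q₂ Q₃).PosDef)
    (hRS₁ : (Matrix.fromBlocks R₁ S₁ S₁ᵀ R₁).PosSemidef)
    (hRS₂ : (Matrix.fromBlocks R₂ S₂ S₂ᵀ R₂).PosSemidef)
    (hF₀ : X₀ * Q₃ * F₀ = X₁ * Q₃) (hF₁ : X₀ * Q₃ * F₁ = X₁ * Q₂)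
    (hF₂ : X₀ * Q₃ * F₂ = X₁ * Q₁) : DelayExpStable F₀ F₁ F₂ h := by
  obtain ⟨a, ha, hPa⟩ := exists_pos_mul_dotProduct_self_le hP
  obtain ⟨c, hc, hΦc⟩ := exists_pos_mul_dotProduct_self_le hΦ
  have hR : (R₁ + R₂).PosSemidef :=
    (posSemidef_of_fromBlocks hRS₁).add (posSemidef_of_fromBlocks hRS₂)
  have hb : 0 < ‖P‖ + ‖S‖ + 4 * h ^ 2 * ‖R₁ + R₂‖ + 1 := by positivity
  refine delayExpStable_of_dissipation (V := lyapunovKrasovskii h P S (R₁ + R₂)) ha hb hc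
    (fun z k => (hPa _).trans (le_lyapunovKrasovskii h P hS hR z k))
    (fun z k => (lyapunovKrasovskii_le h P S (R₁ + R₂) z k).trans ?_) fun z hz k => ?_
  · exact mul_le_mul_of_nonneg_right (le_add_of_nonneg_right zero_le_one)
      (Finset.sum_nonneg fun _ _ => dotProduct_self_nonneg_real _)
  · obtain ⟨i, hi, j, hj, hk⟩ := hz k
    refine lyapunovKrasovskii_dissipation hc.le hΦc hRS₁ hRS₂ hi hj ?_
    simp only [hk, Matrix.mulVec_add, Matrix.mulVec_mulVec, hF₀, hF₁, hF₂]

end LinearMatrixInequality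

section ClosedLoop

variable {n m : ℕ} {A₀ A₁ : Matrix (Fin n) (Fin n) ℝ} {B : Matrix (Fin n) (Fin m) ℝ}

theorem dataMatrix_one_eq {T d₁ d₂ : ℕ} {x : ℤ → Fin n → ℝ} {u : ℤ → Fin m → ℝ}
    (hdata : ∀ k : ℕ, k < T → SystemEqAt A₀ A₁ B x u d₁ d₂ k) :
    dataMatrix x 1 T = A₀ * dataMatrix x 0 T + A₁ * dataMatrix (delayed x d₁) 0 T
      + B * dataMatrix (delayed u d₂) 0 T := by
  ext a t
  have h := congrFun (hdata t t.isLt) a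
  rw [add_comm] at h
  simpa [dataMatrix, delayed, Matrix.mul_apply, Matrix.mulVec, dotProduct] using h

section Trajectory

variable {K : Matrix (Fin m) (Fin n) ℝ} {hbar : ℕ} {h₁ h₂ : ℕ → ℕ} {x : ℤ → Fin n → ℝ}
  {u : ℤ → Fin m → ℝ}

open scoped Matrix.Norms.L2Operator in
theorem IsClosedLoopTrajectory.euclNorm_input_le
    (htraj : IsClosedLoopTrajectory A₀ A₁ B K hbar h₁ h₂ x u) {j : ℤ} (hj : -(hbar : ℤ) ≤ j) :
    euclNorm (u j) ≤ ‖K‖ * euclNorm (x j) := by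
  obtain hu | hu : u j = 0 ∨ u j = K *ᵥ x j :=
    (le_or_gt j 0).elim (htraj.2.2 j hj) fun h => .inr (htraj.2.1 j h)
  · rw [hu, euclNorm_zero]
    exact mul_nonneg (norm_nonneg K) (euclNorm_nonneg _)
  · rw [hu]
    exact euclNorm_mulVec_le K _

open scoped Matrix.Norms.L2Operator in
theorem IsClosedLoopTrajectory.euclNorm_le
    (htraj : IsClosedLoopTrajectory A₀ A₁ B K hbar h₁ h₂ x u) (hh₁ : ∀ k, h₁ k ≤ hbar)
    (hh₂ : ∀ k, h₂ k ≤ hbar) {M : ℝ}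
    (hM : ∀ j : ℤ, -(hbar : ℤ) ≤ j → j ≤ 0 → euclNorm (x j) ≤ M) (k : ℕ) {j : ℤ}
    (hj : -(hbar : ℤ) ≤ j) (hjk : j ≤ k) :
    euclNorm (x j) ≤ (1 + ‖A₀‖ + ‖A₁‖ + ‖B‖ * ‖K‖) ^ k * M := by
  set G := 1 + ‖A₀‖ + ‖A₁‖ + ‖B‖ * ‖K‖
  have hG : 1 ≤ G := by
    linarith [norm_nonneg A₀, norm_nonneg A₁, mul_nonneg (norm_nonneg B) (norm_nonneg K)]
  have hM0 : 0 ≤ M := (euclNorm_nonneg _).trans (hM 0 (by omega) le_rfl)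
  induction k generalizing j with
  | zero => simpa using hM j hj hjk
  | succ k ih =>
    rcases lt_or_eq_of_le hjk with hlt | rfl
    · exact (ih hj (by push_cast at hlt; omega)).trans (by gcongr; exact k.le_succ)
    have hd₁ : -(hbar : ℤ) ≤ k - h₁ k := by linarith [hh₁ k]
    have hd₂ : -(hbar : ℤ) ≤ k - h₂ k := by have := hh₂ k; omega
    have hu : euclNorm (u (k - h₂ k)) ≤ ‖K‖ * (G ^ k * M) :=
      (htraj.euclNorm_input_le hd₂).trans (by gcongr; exact ih hd₂ (by omega))
    calc euclNorm (x ((k + 1 : ℕ) : ℤ))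
        = euclNorm (A₀ *ᵥ x k + A₁ *ᵥ x (k - h₁ k) + B *ᵥ u (k - h₂ k)) := by
          rw [← htraj.1 k, Nat.cast_succ]
      _ ≤ euclNorm (A₀ *ᵥ x k) + euclNorm (A₁ *ᵥ x (k - h₁ k)) + euclNorm (B *ᵥ u (k - h₂ k)) :=
          (euclNorm_add_le _ _).trans (by gcongr; exact euclNorm_add_le _ _)
      _ ≤ ‖A₀‖ * (G ^ k * M) + ‖A₁‖ * (G ^ k * M) + ‖B‖ * (‖K‖ * (G ^ k * M)) := by
          gcongr
          · exact (euclNorm_mulVec_le _ _).trans (by gcongr; exact ih (by omega) le_rfl)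
          · exact (euclNorm_mulVec_le _ _).trans (by gcongr; exact ih hd₁ (by omega))
          · exact (euclNorm_mulVec_le _ _).trans (by gcongr)
      _ ≤ G ^ (k + 1) * M := by
          have : 0 ≤ G ^ k * M := by positivity
          rw [pow_succ]
          linarith

-- The shift by one makes every delayed input a feedback value: past inputs may be zero.
theorem IsClosedLoopTrajectory.isDelaySolution
    (htraj : IsClosedLoopTrajectory A₀ A₁ B K hbar h₁ h₂ x u) (hh₁ : ∀ k, h₁ k ≤ hbar)
    (hh₂ : ∀ k, h₂ k ≤ hbar) :
    IsDelaySolution A₀ A₁ (B * K) hbar fun k => x ((k : ℤ) + 1) := by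
  intro k
  obtain ⟨t, ht⟩ : ∃ t, t = k + hbar + 1 := ⟨_, rfl⟩
  have ht₁ := hh₁ t
  have ht₂ := hh₂ t
  have hsys := htraj.1 t
  rw [SystemEqAt, htraj.2.1 (t - h₂ t) (by omega), Matrix.mulVec_mulVec] at hsys
  refine ⟨hbar - h₁ t, Nat.sub_le _ _, hbar - h₂ t, Nat.sub_le _ _, ?_⟩
  have hnext : ((k + hbar + 1 : ℕ) : ℤ) + 1 = t + 1 := by rw [ht]
  have hcurr : ((k + hbar : ℕ) : ℤ) + 1 = t := by omega
  have hdel₁ : ((k + (hbar - h₁ t) : ℕ) : ℤ) + 1 = t - h₁ t := by omega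
  have hdel₂ : ((k + (hbar - h₂ t) : ℕ) : ℤ) + 1 = t - h₂ t := by omega
  simpa only [hnext, hcurr, hdel₁, hdel₂] using hsys

end Trajectory

open scoped Matrix.Norms.L2Operator in
theorem closedLoopExpStable_of_delayExpStable {K : Matrix (Fin m) (Fin n) ℝ} {hbar : ℕ}
    (hstab : DelayExpStable A₀ A₁ (B * K) hbar) : ClosedLoopExpStable A₀ A₁ B K hbar := by
  obtain ⟨C, ρ, hC, hρ0, hρ1, hdec⟩ := hstab
  set G := 1 + ‖A₀‖ + ‖A₁‖ + ‖B‖ * ‖K‖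
  refine ⟨(1 + C) / ρ ^ (hbar + 1) * G ^ (hbar + 1), ρ, by positivity, hρ0, hρ1,
    fun h₁ h₂ hh₁ hh₂ x u htraj M hM k => ?_⟩
  have hM0 : 0 ≤ M := (euclNorm_nonneg _).trans (hM 0 (by omega) le_rfl)
  have hinit {j : ℤ} (hj : -(hbar : ℤ) ≤ j) (hj' : j ≤ (hbar + 1 : ℕ)) :
      euclNorm (x j) ≤ G ^ (hbar + 1) * M := htraj.euclNorm_le hh₁ hh₂ hM _ hj hj'
  have hshift (j : ℕ) : euclNorm (x ((j + (hbar + 1) : ℕ) : ℤ)) ≤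
      C * ρ ^ j * (G ^ (hbar + 1) * M) := by
    simpa [add_assoc] using hdec _ (htraj.isDelaySolution hh₁ hh₂) (G ^ (hbar + 1) * M)
      (fun l hl => hinit (by omega) (by omega)) j
  calc euclNorm (x k) ≤ (1 + C) / ρ ^ (hbar + 1) * ρ ^ k * (G ^ (hbar + 1) * M) :=
        le_geometric_of_shift (a := fun k => euclNorm (x k)) hC.le hρ0 hρ1.le (by positivity)
          (fun j hj => hinit (by omega) (by omega)) hshift k
    _ = (1 + C) / ρ ^ (hbar + 1) * G ^ (hbar + 1) * ρ ^ k * M := by ring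

end ClosedLoop

theorem theorem1_general {n m T : ℕ} {A₀ A₁ : Matrix (Fin n) (Fin n) ℝ}
    {B : Matrix (Fin n) (Fin m) ℝ} {X₀ X₁ Xh : Matrix (Fin n) (Fin T) ℝ}
    {U : Matrix (Fin m) (Fin T) ℝ} (hX₁ : X₁ = A₀ * X₀ + A₁ * Xh + B * U) {h : ℕ} {ε : ℝ}
    {P S R₁ R₂ S₁ S₂ : Matrix (Fin n) (Fin n) ℝ} {Q₁ Q₂ Q₃ : Matrix (Fin T) (Fin n) ℝ}
    (hP : P.PosDef) (hS : S.PosSemidef)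
    (hΦ : (lmiMatrix X₀ X₁ (h : ℝ) ε P S R₁ R₂ S₁ S₂ Q₁ Q₂ Q₃).PosDef)
    (hRS₁ : (Matrix.fromBlocks R₁ S₁ S₁ᵀ R₁).PosSemidef)
    (hRS₂ : (Matrix.fromBlocks R₂ S₂ S₂ᵀ R₂).PosSemidef)
    (hUQ₂ : U * Q₂ = 0) (hUQ₃ : U * Q₃ = 0) (hXhQ₁ : Xh * Q₁ = 0) (hXhQ₃ : Xh * Q₃ = 0)
    (hXQ₁ : X₀ * Q₁ = 0) (hXQ₂ : X₀ * Q₂ = 0) (hXhQ₂ : Xh * Q₂ = X₀ * Q₃) :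
    IsUnit (X₀ * Q₃) ∧ ClosedLoopExpStable A₀ A₁ B (U * Q₁ * (X₀ * Q₃)⁻¹) h := by
  have hY : IsUnit (X₀ * Q₃) := isUnit_of_lmiMatrix_posDef hP.posSemidef
    (posSemidef_of_fromBlocks hRS₁) (posSemidef_of_fromBlocks hRS₂) hΦ
  refine ⟨hY, closedLoopExpStable_of_delayExpStable ?_⟩
  have hdet := (Matrix.isUnit_iff_isUnit_det _).1 hY
  have hQ₃ : X₁ * Q₃ = A₀ * (X₀ * Q₃) := by
    simp only [hX₁, Matrix.add_mul, Matrix.mul_assoc, hXhQ₃, hUQ₃, Matrix.mul_zero, add_zero]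
  have hQ₂ : X₁ * Q₂ = A₁ * (X₀ * Q₃) := by
    simp only [hX₁, Matrix.add_mul, Matrix.mul_assoc, hXQ₂, hUQ₂, hXhQ₂, Matrix.mul_zero, add_zero,
      zero_add]
  have hQ₁ : X₁ * Q₁ = B * (U * Q₁) := by
    simp only [hX₁, Matrix.add_mul, Matrix.mul_assoc, hXQ₁, hXhQ₁, Matrix.mul_zero, zero_add]
  have hstab : DelayExpStable ((X₀ * Q₃)⁻¹ * (X₁ * Q₃)) ((X₀ * Q₃)⁻¹ * (X₁ * Q₂))
      ((X₀ * Q₃)⁻¹ * (X₁ * Q₁)) h := by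
    apply delayExpStable_of_lmiMatrix_posDef hP hS hΦ hRS₁ hRS₂ <;>
      exact Matrix.mul_nonsing_inv_cancel_left _ _ hdet
  refine hstab.of_leftInverse (Matrix.mul_nonsing_inv _ hdet) ?_ ?_ ?_
  · rw [hQ₃, Matrix.mul_assoc, Matrix.mul_nonsing_inv_cancel_right _ _ hdet]
  · rw [hQ₂, Matrix.mul_assoc, Matrix.mul_nonsing_inv_cancel_right _ _ hdet]
  · simp only [hQ₁, Matrix.mul_assoc]

theorem theorem1 {n m : ℕ}
    -- the (unknown) system and the delay bound
    (A₀ A₁ : Matrix (Fin n) (Fin n) ℝ) (B : Matrix (Fin n) (Fin m) ℝ)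
    (hbar : ℕ) (hbar_pos : 0 < hbar)
    -- the recorded data, generated by the system with constant delays `d₁`, `d₂`
    (T : ℕ) (hT : hbar < T) (d₁ d₂ : ℕ) (hd₁ : d₁ ≤ hbar) (hd₂ : d₂ ≤ hbar)
    (x : ℤ → Fin n → ℝ) (u : ℤ → Fin m → ℝ)
    (hdata : ∀ k : ℕ, k < T → SystemEqAt A₀ A₁ B x u d₁ d₂ k)
    (hrank : (dataW0 x u d₁ d₂ T).rank = m + 2 * n)
    -- the tuning parameter and the decision variables
    (ε : ℝ) (hε : 0 < ε)
    (P S R₁ R₂ S₁ S₂ : Matrix (Fin n) (Fin n) ℝ) (Q₁ Q₂ Q₃ : Matrix (Fin T) (Fin n) ℝ)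
    (hP : P.PosDef) (hS : S.PosDef) (hR₁ : R₁.PosDef) (hR₂ : R₂.PosDef)
    -- the linear matrix inequalities
    (hΦ : (lmiMatrix (dataMatrix x 0 T) (dataMatrix x 1 T) (hbar : ℝ) ε
      P S R₁ R₂ S₁ S₂ Q₁ Q₂ Q₃).PosDef)
    (hRS₁ : (Matrix.fromBlocks R₁ S₁ S₁ᵀ R₁).PosSemidef)
    (hRS₂ : (Matrix.fromBlocks R₂ S₂ S₂ᵀ R₂).PosSemidef)
    -- the equality constraints
    (hUQ₂ : dataMatrix (delayed u d₂) 0 T * Q₂ = 0)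
    (hUQ₃ : dataMatrix (delayed u d₂) 0 T * Q₃ = 0)
    (hXhQ₁ : dataMatrix (delayed x d₁) 0 T * Q₁ = 0)
    (hXhQ₃ : dataMatrix (delayed x d₁) 0 T * Q₃ = 0)
    (hXQ₁ : dataMatrix x 0 T * Q₁ = 0)
    (hXQ₂ : dataMatrix x 0 T * Q₂ = 0)
    (hXhQ₂ : dataMatrix (delayed x d₁) 0 T * Q₂ = dataMatrix x 0 T * Q₃) :
    IsUnit (dataMatrix x 0 T * Q₃) ∧
      ClosedLoopExpStable A₀ A₁ B
        (dataMatrix (delayed u d₂) 0 T * Q₁ * (dataMatrix x 0 T * Q₃)⁻¹) hbar := by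
  exact theorem1_general (dataMatrix_one_eq hdata) hP hS.posSemidef hΦ hRS₁ hRS₂
    hUQ₂ hUQ₃ hXhQ₁ hXhQ₃ hXQ₁ hXQ₂ hXhQ₂
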